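/- A sequence $S$ over a finite abelian group $G$ is a finite unordered list $g_1\cdot\ldots\cdot g_\ell$ of elements of $G$ with repetition allowed. Let $|S|=\ell$ denote its length and $\mathrm{supp}(S)$ the set of its distinct terms. For an integer $k\ge 1$ with $k\le |S|$, let $\Sigma_{\geq k}(S)\subseteq G$ be the set of all sums of subsequences of $S$ of length at least $k$. Let $k\geq 1$ be an integer. For every finite abelian group $G$ and every sequence $S$ over $G$ of length $|S|\geq k+1$ such that $0\notin \mathrm{supp}(S)$ and $0\notin\Sigma_{\geq k}(S)$, we have $$|\Sigma_{\geq k}(S)|\geq |S|-k+|\mathrm{supp}(S)|.$$ Equality holds whenever $|S|=k+1$; moreover, for every $k\geq 1$ there are a finite abelian group $G$ and a sequence $S$ over $G$ with $|S|=k+1$ satisfying these hypotheses, so the bound is attained. -/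

import Mathlib

/-!
A (finite, unordered) sequence over an abelian group `G` is an element of the free abelian monoid
with basis `G`, that is, a `Multiset G`: its length is `Multiset.card S`, the multiplicity of `g` in
it is `Multiset.count g S`, its sum is `Multiset.sum S`, and `T` is a subsequence of `S` exactly when
`T ≤ S`.
-/

namespace SubseqSums

variable {G : Type*}

/-- The support of a sequence: the set of its distinct terms. -/
def supp (S : Multiset G) : Set G := {g | g ∈ S}

/-- `Σ_k(S)`: the set of all sums of subsequences of `S` of length `k`. -/
def kSums [AddCommGroup G] (k : ℕ) (S : Multiset G) : Set G :=
  {g | ∃ T : Multiset G, T ≤ S ∧ Multiset.card T = k ∧ T.sum = g}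

/-- `Σ_{≥ k}(S)`: the union of the sets `Σ_t(S)` for `t` from `k` to the length of `S`. -/
def geSums [AddCommGroup G] (k : ℕ) (S : Multiset G) : Set G :=
  ⋃ t ∈ Set.Icc k (Multiset.card S), kSums t S

end SubseqSums

/-! Induct on `|S|`; at length `k + 1` the sums are σ = `S.sum` and the σ - g, so equality holds.
For longer `S`, write X = Σ_{≥k}(S) and suppose the bound fails. By induction, erasing any term g
loses at most one element of X, so translation by g has at most one exit from X and at most one
entrance. An exit exists, since otherwise X would be invariant under ⟨supp S⟩ and contain σ - σ = 0;
hence no term repeats. By `invariant_diff_singleton_or`, X or its complement is ⟨supp S⟩-invariant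
up to one point. The first case again gives 0 ∈ X. In the second the point is 0 and ⟨supp S⟩ ⊆ X ∪
{0}, so this subgroup has order at most 2|S| - k. Pigeonhole (`exists_subset_card_le_sum_eq`) then
writes σ with at most |S| - k terms, and the remaining terms sum to 0. -/

/-! ### Almost invariant sets -/

/-- A set in a finite group that is closed under the addition of all elements of `U` is closed under
the addition of all elements of the subgroup generated by `U`. -/
theorem add_mem_of_mem_closure {G : Type*} [AddCommGroup G] [Finite G] {U X : Set G}
    (h : ∀ x ∈ X, ∀ u ∈ U, x + u ∈ X) {x y : G} (hx : x ∈ X)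
    (hy : y ∈ AddSubgroup.closure U) : x + y ∈ X := by
  induction hy using AddSubgroup.closure_induction generalizing x with
  | mem u hu => exact h x hx u hu
  | zero => simpa using hx
  | add a b _ _ ha hb => rw [← add_assoc]; exact hb (ha hx)
  | neg a _ ha =>
    have key : ∀ n : ℕ, x + n • a ∈ X := by
      intro n
      induction n with
      | zero => simpa using hx
      | succ n ih => rw [succ_nsmul, ← add_assoc]; exact ha ih
    have hn : -a = (addOrderOf a - 1) • a := by
      rw [neg_eq_iff_add_eq_zero, ← succ_nsmul', Nat.sub_add_cancel (addOrderOf_pos a),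
        addOrderOf_nsmul_eq_zero]
    rw [hn]
    exact key _

/-- If every element of `U` has exactly one exit from `X` and at most one entrance into `X`, then
either `X` is invariant up to one point, or its complement is. -/
theorem invariant_diff_singleton_or {G : Type*} [AddCommGroup G] {U : Finset G} {X : Set G}
    (hU : 3 ≤ U.card)
    (h_exit : ∀ u ∈ U, ∃ x ∈ X, x + u ∉ X)
    (h_exit_unique : ∀ u ∈ U, ∀ x ∈ X, ∀ y ∈ X, x + u ∉ X → y + u ∉ X → x = y)
    (h_entrance_unique : ∀ u ∈ U, ∀ x ∉ X, ∀ y ∉ X, x + u ∈ X → y + u ∈ X → x = y)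
    (h_zero : (0 : G) ∉ U) :
    (∃ e, ∀ x ∈ X \ {e}, ∀ u ∈ U, x + u ∈ X \ {e}) ∨
      ∃ c, c ∉ X ∧ ∀ x ∈ Xᶜ \ {c}, ∀ u ∈ U, x + u ∈ Xᶜ \ {c} := by
  choose! e heX he using h_exit
  have ne_zero : ∀ u ∈ U, u ≠ 0 := fun u hu h => h_zero (h ▸ hu)
  -- Otherwise `e u + v`, which stays in `X` because `v` exits only at `e v`, would be a second exit
  -- for `u`.
  have entrance : ∀ u ∈ U, ∀ v ∈ U, e u ≠ e v → e u + u + v ∈ X := by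
    intro u hu v hv hne
    by_contra hc
    have h1 : e u + v ∈ X := by
      by_contra h
      exact hne (h_exit_unique v hv _ (heX u hu) _ (heX v hv) h (he v hv))
    have h2 := h_exit_unique u hu _ h1 _ (heX u hu) (by rwa [add_right_comm]) (he u hu)
    exact ne_zero v hv (by simpa using h2)
  have start : ∀ u ∈ U, ∀ v ∈ U, u ≠ v → e u = e v → e u - v ∉ X := by
    intro u hu v hv huv heq hmem
    have h1 : e u - v + u ∈ X := by
      by_contra h
      have := h_exit_unique u hu _ hmem _ (heX u hu) h (he u hu)
      exact ne_zero v hv (by simpa using this)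
    have h2 := h_exit_unique v hv _ h1 _ (heX v hv)
      (by rw [add_right_comm, sub_add_cancel]; exact he u hu) (he v hv)
    rw [← heq, sub_add_eq_add_sub, sub_eq_iff_eq_add, add_right_inj] at h2
    exact huv h2
  obtain ⟨a, b, c, ha, hb, hc, hab, hac, hbc⟩ := Finset.two_lt_card_iff.mp hU
  -- A common exit is the exceptional point of `X`. Otherwise the exits are pairwise distinct and
  -- all `e u + u` coincide, giving the exceptional point of the complement.
  by_cases hall : ∀ u ∈ U, e u = e a
  · refine Or.inl ⟨e a, fun x hx u hu => ⟨?_, ?_⟩⟩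
    · by_contra h
      exact hx.2 ((h_exit_unique u hu _ hx.1 _ (heX u hu) h (he u hu)).trans (hall u hu))
    · intro (h : x + u = e a)
      obtain ⟨v, hv, hvu⟩ : ∃ v ∈ U, v ≠ u := by
        by_cases hu' : a = u
        · exact ⟨b, hb, fun h => hab (hu'.trans h.symm)⟩
        · exact ⟨a, ha, hu'⟩
      apply start v hv u hu hvu ((hall v hv).trans (hall u hu).symm)
      rw [hall v hv, ← h, add_sub_cancel_right]
      exact hx.1
  · push Not at hall
    obtain ⟨d, hd, hda⟩ := hall
    have inj : ∀ u ∈ U, ∀ v ∈ U, u ≠ v → e u ≠ e v := by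
      intro u hu v hv huv heq
      obtain ⟨w, hw, hwu⟩ : ∃ w ∈ U, e u ≠ e w := by
        by_cases h : e u = e a
        · exact ⟨d, hd, h ▸ hda.symm⟩
        · exact ⟨a, ha, h⟩
      have := h_entrance_unique w hw _ (he u hu) _ (he v hv) (entrance u hu w hw hwu)
        (entrance v hv w hw (heq ▸ hwu))
      rw [heq, add_right_inj] at this
      exact huv this
    have ent : ∀ u ∈ U, ∀ v ∈ U, u ≠ v → e u + u + v ∈ X :=
      fun u hu v hv h => entrance u hu v hv (inj u hu v hv h)
    have ceq : ∀ u ∈ U, ∀ v ∈ U, e u + u = e v + v := by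
      intro u hu v hv
      obtain ⟨w, hw, hwu, hwv⟩ : ∃ w ∈ U, u ≠ w ∧ v ≠ w := by
        by_contra! h
        have h1 := h a ha
        have h2 := h b hb
        have h3 := h c hc
        grind
      exact h_entrance_unique w hw _ (he u hu) _ (he v hv) (ent u hu w hw hwu)
        (ent v hv w hw hwv)
    refine Or.inr ⟨e a + a, he a ha, fun x hx u hu => ⟨?_, ?_⟩⟩
    · intro h
      obtain ⟨w, hw, hwu⟩ : ∃ w ∈ U, w ≠ u := by
        by_cases hu' : a = u
        · exact ⟨b, hb, fun h => hab (hu'.trans h.symm)⟩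
        · exact ⟨a, ha, hu'⟩
      apply hx.2
      have := h_entrance_unique u hu _ hx.1 _ (he w hw) h (ent w hw u hu hwu)
      exact this.trans (ceq w hw a ha)
    · intro (h : x + u = e a + a)
      rw [ceq a ha u hu, add_left_inj] at h
      exact hx.1 (h ▸ heX u hu)

/-! ### Short representations in small groups -/

/-- The pigeonhole principle for representations of `h` as a sum of two elements of `A`. -/
theorem two_mul_card_le_card_add_card_filter {H : Type*} [AddCommGroup H] [Fintype H]
    [DecidableEq H] (A : Finset H) (h : H) :
    2 * A.card ≤ Fintype.card H + (A.filter fun a => h - a ∈ A).card := by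
  have h1 := Finset.card_union_add_card_inter A (A.image fun a => h - a)
  rw [Finset.card_image_of_injective _ sub_right_injective] at h1
  have h2 := Finset.card_le_univ (A ∪ A.image fun a => h - a)
  have h3 : A ∩ A.image (fun a => h - a) = A.filter fun a => h - a ∈ A := by
    ext x
    simp only [Finset.mem_inter, Finset.mem_image, Finset.mem_filter, and_congr_right_iff]
    refine fun _ => ⟨?_, fun hx => ⟨_, hx, sub_sub_cancel _ _⟩⟩
    rintro ⟨a, ha, rfl⟩
    simpa using ha
  rw [h3] at h1
  omega

/-- In a finite group of order less than `2|S|`, and at most `|S| + r`, the sum of the set `S` is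
the sum of at most `r` elements of `S`. -/
theorem exists_subset_card_le_sum_eq {H : Type*} [AddCommGroup H] [Finite H] (S : Finset H)
    (r : ℕ) (hr : 2 ≤ r) (hrS : r + 1 ≤ S.card) (hH : Nat.card H ≤ S.card + r) (h0 : (0 : H) ∉ S)
    {s : H} (hs : s ≠ 0) : ∃ T ⊆ S, T.card ≤ r ∧ ∑ x ∈ T, x = s := by
  classical
  have := Fintype.ofFinite H
  rw [Nat.card_eq_fintype_card] at hH
  -- Adjoining 0 allows fewer summands; it is erased at the end.
  set A := insert 0 S with hA
  have hAcard : A.card = S.card + 1 := Finset.card_insert_of_notMem h0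
  have sub : ∀ T ⊆ A, T.erase 0 ⊆ S := fun T hT => by
    rw [← Finset.erase_insert h0]; exact Finset.erase_subset_erase _ hT
  have sumE : ∀ T : Finset H, ∑ x ∈ T.erase 0, x = ∑ x ∈ T, x :=
    fun T => Finset.sum_erase _ rfl
  set N := A.filter fun a => s - a ∈ A with hN
  have hNcard := two_mul_card_le_card_add_card_filter A s
  rw [← hN] at hNcard
  by_cases hdist : ∃ a ∈ N, a ≠ s - a
  · obtain ⟨a, ha, hne⟩ := hdist
    rw [hN, Finset.mem_filter] at ha
    refine ⟨({a, s - a} : Finset H).erase 0, sub _ ?_, ?_, ?_⟩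
    · simp [Finset.insert_subset_iff, ha.1, ha.2]
    · exact (Finset.card_erase_le.trans Finset.card_le_two).trans hr
    · rw [sumE, Finset.sum_pair hne, add_sub_cancel]
  -- Now every representation of `s` is a doubling, so `N` lies in one coset of the kernel of `D`.
  push Not at hdist
  set D : H →+ H := nsmulAddMonoidHom 2 with hD
  have hDapp : ∀ x, D x = x + x := fun x => two_nsmul x
  have hDN : ∀ a ∈ N, D a = s := fun a ha => by
    rw [hDapp]; nth_rewrite 2 [hdist a ha]; exact add_sub_cancel _ _
  obtain ⟨a₀, ha₀⟩ : N.Nonempty := Finset.card_pos.mp (by omega)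
  have hker : N.card ≤ Nat.card D.ker := by
    have h1 : (N.image fun a => a - a₀ : Set H).ncard ≤ (D.ker : Set H).ncard := by
      refine Set.ncard_le_ncard (fun x hx => ?_) (Set.toFinite _)
      obtain ⟨a, ha, rfl⟩ := Finset.mem_image.mp hx
      simp [AddMonoidHom.mem_ker, hDN a ha, hDN a₀ ha₀]
    rwa [Set.ncard_coe_finset, Finset.card_image_of_injective _ sub_left_injective] at h1
  have hmul : Nat.card D.ker * Nat.card D.range = Fintype.card H := by
    rw [← AddSubgroup.index_ker, AddSubgroup.card_mul_index, Nat.card_eq_fintype_card]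
  have hrange : 2 ≤ Nat.card D.range := by
    refine (AddSubgroup.one_lt_card_iff_ne_bot _).mpr fun h => hs ?_
    rw [← AddSubgroup.mem_bot, ← h]
    exact ⟨a₀, hDN a₀ ha₀⟩
  rcases hr.eq_or_lt with rfl | hr3
  · nlinarith
  -- Since `N` has at least 3 elements, the range of `D` is too small to contain `S`. For `t`
  -- outside it, `s - t` is not of the form `a + a`, because `s` is itself a double.
  obtain ⟨t, htS, ht⟩ : ∃ t ∈ S, t ∉ D.range := by
    by_contra! h
    have h1 : S.card ≤ Nat.card D.range := by
      have := Set.ncard_le_ncard (s := (S : Set H)) (t := (D.range : Set H)) h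
      rwa [Set.ncard_coe_finset] at this
    nlinarith
  have hts : t ∈ A := Finset.mem_insert_of_mem htS
  have hcard := two_mul_card_le_card_add_card_filter (A.erase t) (s - t)
  rw [Finset.card_erase_of_mem hts] at hcard
  obtain ⟨a, ha⟩ : ((A.erase t).filter fun a => s - t - a ∈ A.erase t).Nonempty :=
    Finset.card_pos.mp (by omega)
  simp only [Finset.mem_filter, Finset.mem_erase] at ha
  obtain ⟨⟨hat, haA⟩, hbt, hbA⟩ := ha
  have hne : a ≠ s - t - a := by
    intro h
    apply ht
    refine ⟨a₀ - a, ?_⟩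
    rw [map_sub, hDN a₀ ha₀, hDapp]
    nth_rewrite 2 [h]
    abel
  refine ⟨({t, a, s - t - a} : Finset H).erase 0, sub _ ?_, ?_, ?_⟩
  · simp [Finset.insert_subset_iff, hts, haA, hbA]
  · exact (Finset.card_erase_le.trans Finset.card_le_three).trans hr3
  · rw [sumE, Finset.sum_insert (by simp [hat.symm, hbt.symm]), Finset.sum_pair hne]
    abel

/-! ### Sums of long subsequences -/

namespace SubseqSums

variable {G : Type*} [AddCommGroup G]

theorem mem_geSums {k : ℕ} {S : Multiset G} {g : G} :
    g ∈ geSums k S ↔ ∃ T ≤ S, k ≤ Multiset.card T ∧ T.sum = g := by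
  simp only [geSums, kSums, Set.mem_iUnion, Set.mem_ofPred_eq, Set.mem_Icc]
  constructor
  · rintro ⟨t, ht, T, hT, rfl, h⟩
    exact ⟨T, hT, ht.1, h⟩
  · rintro ⟨T, hT, hk, h⟩
    exact ⟨_, ⟨hk, Multiset.card_le_card hT⟩, T, hT, rfl, h⟩

theorem geSums_mono {k : ℕ} {S S' : Multiset G} (h : S' ≤ S) : geSums k S' ⊆ geSums k S := by
  intro g
  simp only [mem_geSums]
  rintro ⟨T, hT, hk⟩
  exact ⟨T, hT.trans h, hk⟩

theorem add_mem_geSums [DecidableEq G] {k : ℕ} {S : Multiset G} {g x : G} (hg : g ∈ S)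
    (hx : x ∈ geSums k (S.erase g)) : x + g ∈ geSums k S := by
  obtain ⟨T, hT, hk, rfl⟩ := mem_geSums.mp hx
  refine mem_geSums.mpr ⟨g ::ₘ T, ?_, ?_, ?_⟩
  · rw [← Multiset.cons_erase hg]
    exact Multiset.cons_le_cons g hT
  · rw [Multiset.card_cons]; omega
  · rw [Multiset.sum_cons, add_comm]

theorem sum_mem_geSums {k : ℕ} {S : Multiset G} (h : k ≤ Multiset.card S) :
    S.sum ∈ geSums k S :=
  mem_geSums.mpr ⟨S, le_rfl, h, rfl⟩

theorem sum_sub_mem_geSums [DecidableEq G] {k : ℕ} {S : Multiset G}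
    (h : k + 1 ≤ Multiset.card S) {g : G} (hg : g ∈ S) : S.sum - g ∈ geSums k S := by
  refine mem_geSums.mpr ⟨S.erase g, Multiset.erase_le _ _, ?_, ?_⟩
  · rw [Multiset.card_erase_of_mem hg, Nat.pred_eq_sub_one]; omega
  · rw [eq_sub_iff_add_eq', Multiset.sum_erase hg]

theorem supp_eq_coe_toFinset {α : Type*} [DecidableEq α] (S : Multiset α) : supp S = S.toFinset := by
  ext; simp [supp]

theorem finite_supp {α : Type*} (S : Multiset α) : (supp S).Finite := by
  classical
  rw [supp_eq_coe_toFinset]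
  exact Finset.finite_toSet _

/-- A subsequence of length at least `k` omits at most one term. -/
theorem geSums_eq_of_card_eq_add_one [DecidableEq G] {k : ℕ} {S : Multiset G}
    (h : Multiset.card S = k + 1) :
    geSums k S = insert S.sum ((fun g => S.sum - g) '' supp S) := by
  ext x
  constructor
  · intro hx
    obtain ⟨T, hT, hk, rfl⟩ := mem_geSums.mp hx
    obtain ⟨U, rfl⟩ := Multiset.le_iff_exists_add.mp hT
    rw [Multiset.card_add] at h
    obtain hU | hU : Multiset.card U = 0 ∨ Multiset.card U = 1 := by omega
    · rw [Multiset.card_eq_zero] at hU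
      simp [hU]
    · obtain ⟨g, rfl⟩ := Multiset.card_eq_one.mp hU
      exact Or.inr ⟨g, by simp [supp], by simp⟩
  · rintro (rfl | ⟨g, hg, rfl⟩)
    · exact sum_mem_geSums (by omega)
    · exact sum_sub_mem_geSums h.ge hg

theorem ncard_geSums_of_card_eq_add_one {k : ℕ} {S : Multiset G}
    (h : Multiset.card S = k + 1) (h0 : (0 : G) ∉ supp S) :
    (geSums k S).ncard = 1 + (supp S).ncard := by
  classical
  rw [geSums_eq_of_card_eq_add_one h, Set.ncard_insert_of_notMem _ ((finite_supp S).image _),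
    Set.ncard_image_of_injective _ sub_right_injective, add_comm]
  rintro ⟨g, hg, hgs⟩
  rw [sub_eq_self] at hgs
  exact h0 (hgs ▸ hg)

theorem ncard_supp_le_ncard_supp_erase_add_one {α : Type*} [DecidableEq α]
    (S : Multiset α) (g : α) :
    (supp S).ncard ≤ (supp (S.erase g)).ncard + 1 := by
  refine (Set.ncard_le_ncard ?_ ((finite_supp _).insert g)).trans (Set.ncard_insert_le g _)
  intro x hx
  by_cases h : x = g
  · exact Or.inl h
  · exact Or.inr ((Multiset.mem_erase_of_ne h).mpr hx)

theorem supp_erase_of_one_lt_count {α : Type*} [DecidableEq α] {S : Multiset α} {g : α}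
    (h : 1 < S.count g) : supp (S.erase g) = supp S := by
  ext x
  by_cases hx : x = g
  · subst hx
    simp only [supp, Set.mem_ofPred_eq, ← Multiset.count_pos, Multiset.count_erase_self]
    omega
  · exact Multiset.mem_erase_of_ne hx

/-! ### The induction on the length -/

/-- A sequence of distinct nonzero elements with nonzero sum that generates a subgroup of order at
most `2|S| - k` has a zero-sum subsequence of length at least `k`. -/
theorem zero_mem_geSums_of_nodup [Finite G] {k : ℕ} (hk : 1 ≤ k) {S : Multiset G}
    (hS : S.Nodup) (hcard : k + 2 ≤ Multiset.card S) (h0 : (0 : G) ∉ supp S)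
    (hH : Nat.card (AddSubgroup.closure (supp S)) + k ≤ 2 * Multiset.card S)
    (hs : S.sum ≠ 0) : (0 : G) ∈ geSums k S := by
  classical
  set H := AddSubgroup.closure (supp S) with hHdef
  have hmem : ∀ x ∈ S.toFinset, x ∈ H := fun x hx =>
    AddSubgroup.subset_closure (Multiset.mem_toFinset.mp hx)
  have hval : S.toFinset.val = S := by rw [Multiset.toFinset_val, hS.dedup]
  have hsum : S.sum = ∑ x ∈ S.toFinset, x := by
    rw [Finset.sum_eq_multiset_sum, hval, Multiset.map_id']
  have hsH : S.sum ∈ H := hsum ▸ AddSubgroup.sum_mem H hmem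
  have hmap := Finset.subtype_map_of_mem hmem
  have hcardH : (S.toFinset.subtype (· ∈ H)).card = Multiset.card S := by
    rw [← Finset.card_map, hmap, Finset.card_def, hval]
  obtain ⟨T, hT, hTcard, hTsum⟩ := exists_subset_card_le_sum_eq
    (S.toFinset.subtype (· ∈ H)) (Multiset.card S - k) (by omega) (by omega) (by omega)
    (by simpa [supp] using h0) (s := ⟨S.sum, hsH⟩) (fun h => hs (congrArg Subtype.val h))
  set T' := T.map (Function.Embedding.subtype (· ∈ H)) with hT'
  have hle : T'.val ≤ S := by
    rw [← hval, Finset.val_le_iff, ← hmap]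
    exact Finset.map_subset_map.mpr hT
  have hT'sum : T'.val.sum = S.sum := by
    have h1 : ∑ x ∈ T', x = S.sum := by
      rw [hT', Finset.sum_map]
      have := congrArg H.subtype hTsum
      rwa [map_sum] at this
    rwa [Finset.sum_eq_multiset_sum, Multiset.map_id'] at h1
  have hT'card : Multiset.card T'.val ≤ Multiset.card S - k := by
    rwa [← Finset.card_def, hT', Finset.card_map]
  refine mem_geSums.mpr ⟨S - T'.val, Multiset.sub_le_self _ _, ?_, ?_⟩
  · rw [Multiset.card_sub hle]; omega
  · have h1 := congrArg Multiset.sum (Multiset.sub_add_cancel hle)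
    rwa [Multiset.sum_add, hT'sum, add_eq_right] at h1

/-- The inductive step of the lower bound for `|Σ_{≥ k}(S)|`. -/
theorem card_add_ncard_supp_le_of_erase [Finite G] [DecidableEq G] {k : ℕ} (hk : 1 ≤ k)
    {S : Multiset G} (hcard : k + 2 ≤ Multiset.card S) (h0 : (0 : G) ∉ geSums k S)
    (hsupp : (0 : G) ∉ supp S)
    (ih : ∀ g ∈ S, Multiset.card (S.erase g) + (supp (S.erase g)).ncard ≤
      (geSums k (S.erase g)).ncard + k) :
    Multiset.card S + (supp S).ncard ≤ (geSums k S).ncard + k := by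
  by_contra! hlt
  set X := geSums k S with hX
  have hsum : S.sum ∈ X := sum_mem_geSums (by omega)
  have hsub : ∀ g, geSums k (S.erase g) ⊆ X := fun g => geSums_mono (Multiset.erase_le _ _)
  have hne : ∀ g ∈ S, g ≠ 0 := fun g hg h => hsupp (h ▸ hg)
  have card_le : ∀ g ∈ S, X.ncard ≤ (geSums k (S.erase g)).ncard + 1 := by
    intro g hg
    have h1 := ih g hg
    have h2 := ncard_supp_le_ncard_supp_erase_add_one S g
    rw [Multiset.card_erase_of_mem hg, Nat.pred_eq_sub_one] at h1
    omega
  have exit_unique : ∀ u ∈ S, ∀ x ∈ X, ∀ y ∈ X, x + u ∉ X → y + u ∉ X → x = y := by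
    intro u hu x hx y hy hxu hyu
    have h1 : (X \ geSums k (S.erase u)).ncard ≤ 1 := by
      rw [Set.ncard_sdiff (hsub u)]
      have := card_le u hu
      omega
    exact (Set.ncard_le_one (Set.toFinite _)).mp h1 _ ⟨hx, fun h => hxu (add_mem_geSums hu h)⟩ _
      ⟨hy, fun h => hyu (add_mem_geSums hu h)⟩
  have entrance_unique : ∀ u ∈ S, ∀ x ∉ X, ∀ y ∉ X, x + u ∈ X → y + u ∈ X → x = y := by
    intro u hu x hx y hy hxu hyu
    have himage : (· + u) '' geSums k (S.erase u) ⊆ X := by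
      rintro _ ⟨z, hz, rfl⟩
      exact add_mem_geSums hu hz
    have h1 : (X \ (· + u) '' geSums k (S.erase u)).ncard ≤ 1 := by
      rw [Set.ncard_sdiff himage, Set.ncard_image_of_injective _ (add_left_injective u)]
      have := card_le u hu
      omega
    have h2 : ∀ z ∉ X, z + u ∉ (· + u) '' geSums k (S.erase u) := by
      rintro z hz ⟨w, hw, hwz⟩
      exact hz (add_left_injective u hwz ▸ hsub u hw)
    exact add_left_injective u ((Set.ncard_le_one (Set.toFinite _)).mp h1 _ ⟨hxu, h2 x hx⟩ _ ⟨hyu, h2 y hy⟩)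
  have sum_mem_closure : S.sum ∈ AddSubgroup.closure (supp S) :=
    AddSubgroup.multiset_sum_mem _ _ fun x hx => AddSubgroup.subset_closure hx
  have not_invariant : ¬ ∀ x ∈ X, ∀ u ∈ supp S, x + u ∈ X := by
    intro h
    have := add_mem_of_mem_closure h hsum (neg_mem sum_mem_closure)
    rw [add_neg_cancel] at this
    exact h0 this
  have exit : ∀ g ∈ S, ∃ x ∈ X, x + g ∉ X := by
    intro g hg
    by_contra! hgX
    -- By finiteness `X` is also invariant under `-g`, so an exit `x` for `u` would yield a second
    -- exit `x + g`.
    refine not_invariant fun x hx u hu => ?_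
    by_contra hxu
    have h1 := exit_unique u hu x hx (x + g) (hgX x hx) hxu ?_
    · exact hne g hg (by simpa using h1)
    · intro hmem
      apply hxu
      have h2 := add_mem_of_mem_closure (U := {g})
        (by simpa using hgX) hmem (neg_mem (AddSubgroup.subset_closure rfl))
      rwa [add_right_comm, add_neg_cancel_right] at h2
  have nodup : S.Nodup := by
    rw [Multiset.nodup_iff_count_le_one]
    intro g
    by_contra! hg
    have hgS : g ∈ S := Multiset.count_pos.mp (by omega)
    have h1 := ih g hgS
    rw [Multiset.card_erase_of_mem hgS, Nat.pred_eq_sub_one, supp_erase_of_one_lt_count hg] at h1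
    have heq := Set.eq_of_subset_of_ncard_le (hsub g) (by omega)
    obtain ⟨x, hx, hxg⟩ := exit g hgS
    rw [← heq] at hx
    exact hxg (add_mem_geSums hgS hx)
  have hfin : S.toFinset.card = Multiset.card S := Multiset.toFinset_card_of_nodup nodup
  have hsuppcard : (supp S).ncard = Multiset.card S := by
    rw [supp_eq_coe_toFinset, Set.ncard_coe_finset, hfin]
  rcases invariant_diff_singleton_or (U := S.toFinset) (X := X) (by omega)
    (by simpa using exit) (by simpa using exit_unique) (by simpa using entrance_unique)
    (by simpa [supp] using hsupp) with ⟨e, he⟩ | ⟨c, hc, hcX⟩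
  · have key : ∀ x ∈ X, ∀ y ∈ AddSubgroup.closure (supp S), x ≠ e → x + y ∈ X := by
      intro x hx y hy hxe
      rw [supp_eq_coe_toFinset] at hy
      exact (add_mem_of_mem_closure (by simpa using he) (show x ∈ X \ {e} from ⟨hx, hxe⟩) hy).1
    obtain ⟨g, hg⟩ := Multiset.card_pos_iff_exists_mem.mp (show 0 < Multiset.card S by omega)
    -- If σ is the exceptional point, σ - g serves as the starting point instead.
    by_cases hse : S.sum = e
    · have h1 := key (S.sum - g) (sum_sub_mem_geSums (by omega) hg) (-(S.sum - g))
        (neg_mem (sub_mem sum_mem_closure (AddSubgroup.subset_closure hg)))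
        (fun h => hne g hg (by rwa [← hse, sub_eq_self] at h))
      rw [add_neg_cancel] at h1
      exact h0 h1
    · have h1 := key S.sum hsum _ (neg_mem sum_mem_closure) hse
      rw [add_neg_cancel] at h1
      exact h0 h1
  · have key : ∀ x ∉ X, ∀ y ∈ AddSubgroup.closure (supp S), x ≠ c → x + y ∉ X := by
      intro x hx y hy hxc
      rw [supp_eq_coe_toFinset] at hy
      exact (add_mem_of_mem_closure (by simpa using hcX)
        (show x ∈ Xᶜ \ {c} from ⟨hx, hxc⟩) hy).1
    -- 0 lies outside `X`, yet adding σ moves it into `X`.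
    have hc0 : 0 = c := by
      by_contra h
      exact key 0 h0 _ sum_mem_closure h (by rwa [zero_add])
    have hHX : (AddSubgroup.closure (supp S) : Set G) ⊆ insert 0 X := by
      intro h hh
      by_contra hhX
      rw [Set.mem_insert_iff, not_or] at hhX
      exact key h hhX.2 _ (sub_mem sum_mem_closure hh) (hc0 ▸ hhX.1)
        (by rwa [add_sub_cancel])
    have hHcard := (Set.ncard_le_ncard hHX).trans (Set.ncard_insert_le 0 X)
    change Nat.card (AddSubgroup.closure (supp S)) ≤ _ at hHcard
    exact h0 (zero_mem_geSums_of_nodup hk nodup hcard hsupp (by omega)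
      fun h => h0 (h ▸ hsum))

/-- The lower bound for `|Σ_{≥ k}(S)|`. -/
theorem card_add_ncard_supp_le [Finite G] {k : ℕ} (hk : 1 ≤ k) (S : Multiset G)
    (hcard : k + 1 ≤ Multiset.card S) (h0 : (0 : G) ∉ geSums k S) (hsupp : (0 : G) ∉ supp S) :
    Multiset.card S + (supp S).ncard ≤ (geSums k S).ncard + k := by
  classical
  induction S using Multiset.strongInductionOn with
  | ih S ih =>
    rcases hcard.eq_or_lt with h | h
    · rw [ncard_geSums_of_card_eq_add_one h.symm hsupp]
      omega
    · refine card_add_ncard_supp_le_of_erase hk h h0 hsupp fun g hg => ?_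
      refine ih _ (Multiset.erase_lt.mpr hg) ?_
        (fun h' => h0 (geSums_mono (Multiset.erase_le _ _) h'))
        (fun h' => hsupp (Multiset.mem_of_mem_erase h'))
      rw [Multiset.card_erase_of_mem hg, Nat.pred_eq_sub_one]
      omega

/-! ### Attaining the bound -/

/-- The sums are the residues of `k` and `k + 1`, both positive and below the modulus. -/
theorem zero_notMem_geSums_replicate (k : ℕ) (hk : 1 ≤ k) :
    (0 : ZMod (k + 2)) ∉ geSums k (Multiset.replicate (k + 1) (1 : ZMod (k + 2))) := by
  intro h
  obtain ⟨T, hT, hkT, hT0⟩ := mem_geSums.mp h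
  obtain ⟨j, hj, rfl⟩ := Multiset.le_replicate_iff.mp hT
  rw [Multiset.card_replicate] at hkT
  rw [Multiset.sum_replicate, nsmul_one, ZMod.natCast_eq_zero_iff] at hT0
  have := Nat.le_of_dvd (by omega) hT0
  omega

end SubseqSums

theorem mainTheorem3 (k : ℕ) (hk : 1 ≤ k) :
    (∀ (G : Type*) [AddCommGroup G] [Finite G] (S : Multiset G),
      k + 1 ≤ Multiset.card S →
      (0 : G) ∉ SubseqSums.geSums k S →
      (0 : G) ∉ SubseqSums.supp S →
        Multiset.card S - k + (SubseqSums.supp S).ncard ≤ (SubseqSums.geSums k S).ncard ∧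
        (Multiset.card S = k + 1 →
          (SubseqSums.geSums k S).ncard = Multiset.card S - k + (SubseqSums.supp S).ncard)) ∧
    (∃ (G : Type) (_ : AddCommGroup G) (_ : Finite G) (S : Multiset G),
      Multiset.card S = k + 1 ∧
      (0 : G) ∉ SubseqSums.geSums k S ∧
      (0 : G) ∉ SubseqSums.supp S ∧
      (SubseqSums.geSums k S).ncard = Multiset.card S - k + (SubseqSums.supp S).ncard) := by
  refine ⟨fun G _ _ S hS h0 hsupp => ⟨?_, fun h => ?_⟩, ?_⟩
  · have := SubseqSums.card_add_ncard_supp_le hk S hS h0 hsupp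
    omega
  · rw [SubseqSums.ncard_geSums_of_card_eq_add_one h hsupp, h, Nat.add_sub_cancel_left]
  · have : Fact (1 < k + 2) := ⟨by omega⟩
    have h1 : (0 : ZMod (k + 2)) ∉ SubseqSums.supp (Multiset.replicate (k + 1) 1) := fun h =>
      zero_ne_one (Multiset.eq_of_mem_replicate h)
    refine ⟨ZMod (k + 2), inferInstance, inferInstance, Multiset.replicate (k + 1) 1,
      Multiset.card_replicate _ _, SubseqSums.zero_notMem_geSums_replicate k hk, h1, ?_⟩
    rw [SubseqSums.ncard_geSums_of_card_eq_add_one (Multiset.card_replicate _ _) h1,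
      Multiset.card_replicate, Nat.add_sub_cancel_left]
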